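/- Let $\mathbb{G}$ be a Carnot group of step $2$ with layers of dimensions $m_1$ and $m_2\ge 1$, identified through exponential coordinates with $\mathbb{R}^n=\mathbb{R}^{m_1}\times\mathbb{R}^{m_2}$. Its points are written $p=[p^1,p^2]$ and its group law is $[p^1,p^2]\cdot[q^1,q^2]=[p^1+q^1,\,p^2+q^2+P(p^1,q^1)]$, where $P=(P_j)_j$, $P_j(x,y)=\sum_{1\le l<i\le m_1} b^j_{l,i}(x_l y_i-x_i y_l)$ with $b^j_{l,i}\in\mathbb{R}$, and the commutators of the first layer span the second. Let $$d_\infty(p,q)=\max\{|p^1-q^1|,\ c\,|p^2-q^2+P(p^1,q^1)|^{1/2}\},$$ where $c\in(0,1)$ is a constant for which $d_\infty$ is a metric. For a metric $d$, let $\mathcal{H}^s$ be the Hausdorff measure $\mathcal{H}^s(A)=\lim_{\eta\to0}\inf\{\sum_j \operatorname{diam}(A_j)^s : A\subset\bigcup_j A_j,\ \operatorname{diam}(A_j)<\eta\}$; write $\mathcal{H}^s_E$ for the one of the Euclidean metric and $\mathcal{H}^s_{\mathbb{G}}$ for the one of $d_\infty$. Let $B_E(p,r)$ be the closed Euclidean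 ball, let $V(p)=\{p\cdot[v,0] : v\in\mathbb{R}^{m_1}\}$ be the horizontal plane through $p$, and let $V(p)(\rho)$ be the set of points at Euclidean distance at most $\rho$ from $V(p)$. Let $s\ge m_2$ be real and let $A\subset\mathbb{G}$ be any set with $\mathcal{H}^s_E(A)<\infty$. Then for $\mathcal{H}^{s+m_2}_{\mathbb{G}}$-almost every $p\in A$ there exists $\delta>0$ such that $$\limsup_{r\to0}\frac{\mathcal{H}^s_E\big(A\cap B_E(p,r)\setminus V(p)(\delta r)\big)}{(2r)^s}>\frac{1}{2^{s+1}}.$$ -/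

import Mathlib

open MeasureTheory Filter Topology
open scoped ENNReal

/-- The vector space `ℝⁿ = ℝ^{m₁} × ℝ^{m₂}` with its Euclidean metric; a point `p = [p¹, p²]` has
components `p.fst` and `p.snd`, and `|p|² = |p¹|² + |p²|²`. -/
abbrev Coord (m₁ m₂ : ℕ) : Type :=
  WithLp 2 (EuclideanSpace ℝ (Fin m₁) × EuclideanSpace ℝ (Fin m₂))

namespace Coord

variable {m₁ m₂ : ℕ}

/-- The point `[x, t]`. -/
def mk (x : EuclideanSpace ℝ (Fin m₁)) (t : EuclideanSpace ℝ (Fin m₂)) : Coord m₁ m₂ :=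
  WithLp.toLp 2 (x, t)

theorem mk_fst (x : EuclideanSpace ℝ (Fin m₁)) (t : EuclideanSpace ℝ (Fin m₂)) :
    (mk x t).fst = x := rfl

theorem mk_snd (x : EuclideanSpace ℝ (Fin m₁)) (t : EuclideanSpace ℝ (Fin m₂)) :
    (mk x t).snd = t := rfl

theorem ext_iff' {p q : Coord m₁ m₂} : p = q ↔ p.fst = q.fst ∧ p.snd = q.snd := by
  constructor
  · rintro rfl
    exact ⟨rfl, rfl⟩
  · rintro ⟨h1, h2⟩
    exact WithLp.ofLp_injective 2 (Prod.ext h1 h2)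

/-- The first layer `V₁ = {[x, 0]}`. -/
def layerOne (m₁ m₂ : ℕ) : Submodule ℝ (Coord m₁ m₂) where
  carrier := {p | p.snd = 0}
  add_mem' := by
    intro a b ha hb
    simp only [Set.mem_ofPred_eq] at ha hb ⊢
    simp [ha, hb]
  zero_mem' := by simp
  smul_mem' := by
    intro k a ha
    simp only [Set.mem_ofPred_eq] at ha ⊢
    simp [ha]

/-- The second layer `V₂ = {[0, t]}`. -/
def layerTwo (m₁ m₂ : ℕ) : Submodule ℝ (Coord m₁ m₂) where
  carrier := {p | p.fst = 0}
  add_mem' := by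
    intro a b ha hb
    simp only [Set.mem_ofPred_eq] at ha hb ⊢
    simp [ha, hb]
  zero_mem' := by simp
  smul_mem' := by
    intro k a ha
    simp only [Set.mem_ofPred_eq] at ha ⊢
    simp [ha]

end Coord

/-- The polynomial map `P = (P_j)_j` with
`P_j(x, y) = ∑_{l < i} b^j_{l,i} (x_l y_i - x_i y_l)`. -/
noncomputable def carnotPoly {m₁ m₂ : ℕ} (b : Fin m₂ → Fin m₁ → Fin m₁ → ℝ)
    (x y : EuclideanSpace ℝ (Fin m₁)) : EuclideanSpace ℝ (Fin m₂) :=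
  WithLp.toLp 2 fun j => ∑ l, ∑ i ∈ Finset.Ioi l, b j l i * (x l * y i - x i * y l)

/-- The Lie bracket on `ℝⁿ`, read as the Lie algebra of the group with product
`[p¹ + q¹, p² + q² + P(p¹, q¹)]` in exponential coordinates: by the Baker-Campbell-Hausdorff
formula `p · q = p + q + [p, q] / 2`, so `[p, q] = [0, 2 P(p¹, q¹)]`. -/
noncomputable def carnotBracket {m₁ m₂ : ℕ} (b : Fin m₂ → Fin m₁ → Fin m₁ → ℝ)
    (p q : Coord m₁ m₂) : Coord m₁ m₂ :=
  Coord.mk 0 ((2 : ℝ) • carnotPoly b p.fst q.fst)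

/-- A Carnot group of step `2` in exponential coordinates, with layers of dimensions `m₁` and `m₂`.
It is given by the coefficients `b` of its group law, subject to `V₂ ≠ {0}` and `[V₁, V₁] = V₂`;
the remaining condition `[V₁, V₂] = {0}` holds by the form of the bracket. -/
structure StepTwoCarnotGroup (m₁ m₂ : ℕ) where
  /-- The coefficients `b^j_{l,i}`; only those with `l < i` are used. -/
  b : Fin m₂ → Fin m₁ → Fin m₁ → ℝ
  /-- The second layer is not trivial. -/
  step_two : 0 < m₂
  /-- The commutators of elements of the first layer span the second layer. -/
  stratified : Submodule.span ℝ {Z : Coord m₁ m₂ | ∃ X ∈ Coord.layerOne m₁ m₂,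
    ∃ Y ∈ Coord.layerOne m₁ m₂, Z = carnotBracket b X Y} = Coord.layerTwo m₁ m₂

namespace StepTwoCarnotGroup

variable {m₁ m₂ : ℕ} (G : StepTwoCarnotGroup m₁ m₂)

/-- The map `P` of the group law. -/
noncomputable def P (x y : EuclideanSpace ℝ (Fin m₁)) : EuclideanSpace ℝ (Fin m₂) :=
  carnotPoly G.b x y

theorem P_self (x : EuclideanSpace ℝ (Fin m₁)) : G.P x x = 0 := by
  ext j
  simp [P, carnotPoly, mul_comm]

theorem P_neg_swap (x y : EuclideanSpace ℝ (Fin m₁)) : G.P y x = -G.P x y := by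
  ext j
  simp only [P, carnotPoly, PiLp.neg_apply, ← Finset.sum_neg_distrib]
  refine Finset.sum_congr rfl fun l _ => Finset.sum_congr rfl fun i _ => ?_
  ring

theorem P_add_left (x x' y : EuclideanSpace ℝ (Fin m₁)) :
    G.P (x + x') y = G.P x y + G.P x' y := by
  ext j
  simp only [P, carnotPoly, PiLp.add_apply, ← Finset.sum_add_distrib]
  refine Finset.sum_congr rfl fun l _ => Finset.sum_congr rfl fun i _ => ?_
  ring

theorem P_add_right (x y y' : EuclideanSpace ℝ (Fin m₁)) :
    G.P x (y + y') = G.P x y + G.P x y' := by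
  rw [P_neg_swap, P_add_left, P_neg_swap G x y, P_neg_swap G x y']
  abel

/-- The group operation `[p¹, p²] · [q¹, q²] = [p¹ + q¹, p² + q² + P(p¹, q¹)]`. -/
noncomputable def mul (p q : Coord m₁ m₂) : Coord m₁ m₂ :=
  Coord.mk (p.fst + q.fst) (p.snd + q.snd + G.P p.fst q.fst)

/-- The operation makes `ℝⁿ` a group, with unit `0` and inverse `-p`. -/
@[reducible] noncomputable def group : Group (Coord m₁ m₂) :=
  { mul := G.mul
    one := 0
    inv := fun p => -p
    mul_assoc := fun p q w => by
      change G.mul (G.mul p q) w = G.mul p (G.mul q w)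
      rw [Coord.ext_iff']
      simp only [mul, Coord.mk_fst, Coord.mk_snd, P_add_left, P_add_right]
      constructor <;> abel
    one_mul := fun p => by
      change G.mul 0 p = p
      have h : G.P 0 p.fst = 0 := by
        have := G.P_add_left 0 0 p.fst
        simpa using this
      rw [Coord.ext_iff']
      simp [mul, Coord.mk_fst, Coord.mk_snd, h]
    mul_one := fun p => by
      change G.mul p 0 = p
      have h : G.P p.fst 0 = 0 := by
        have := G.P_add_right p.fst 0 0
        simpa using this
      rw [Coord.ext_iff']
      simp [mul, Coord.mk_fst, Coord.mk_snd, h]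
    inv_mul_cancel := fun p => by
      change G.mul (-p) p = 0
      have h : G.P (-p.fst) p.fst = 0 := by
        have h0 : G.P 0 p.fst = 0 := by
          have := G.P_add_left 0 0 p.fst
          simpa using this
        have := G.P_add_left (-p.fst) p.fst p.fst
        rw [neg_add_cancel, h0, P_self, add_zero] at this
        exact this.symm
      rw [Coord.ext_iff']
      simp [mul, Coord.mk_fst, Coord.mk_snd, h] }

/-- The horizontal plane `V(p)`: the left translate by `p` of the horizontal layer
`{[v, 0] : v ∈ ℝ^{m₁}}`. -/
def horizontalPlane (p : Coord m₁ m₂) : Set (Coord m₁ m₂) :=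
  (fun v => G.mul p v) '' (Coord.layerOne m₁ m₂ : Set (Coord m₁ m₂))

/-- `d_∞(p, q) = max {|p¹ - q¹|, c |p² - q² + P(p¹, q¹)|^{1/2}}`. -/
noncomputable def dInf (c : ℝ) (p q : Coord m₁ m₂) : ℝ :=
  max ‖p.fst - q.fst‖ (c * Real.sqrt ‖p.snd - q.snd + G.P p.fst q.fst‖)

/-- The constant `c` is suitable if `c ∈ (0, 1)` and `d_∞` satisfies the triangle inequality (the
only axiom of a metric that can fail for positive `c`). -/
def IsSuitable (c : ℝ) : Prop :=
  0 < c ∧ c < 1 ∧ ∀ p q w : Coord m₁ m₂, G.dInf c p w ≤ G.dInf c p q + G.dInf c q w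

/-- The set `ℝⁿ`, carrying the metric `d_∞` in place of the Euclidean one. -/
def WithDInf (c : ℝ) (_hc : G.IsSuitable c) : Type :=
  Coord m₁ m₂

noncomputable instance (c : ℝ) (hc : G.IsSuitable c) : MetricSpace (G.WithDInf c hc) where
  dist p q := G.dInf c p q
  dist_self p := by
    simp [dInf, P_self]
  dist_comm p q := by
    unfold dInf
    have e : p.snd - q.snd + G.P p.fst q.fst = -(q.snd - p.snd + G.P q.fst p.fst) := by
      rw [G.P_neg_swap q.fst p.fst]
      abel
    rw [norm_sub_rev, e, norm_neg]
  dist_triangle p q w := hc.2.2 p q w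
  eq_of_dist_eq_zero := by
    intro p q h
    change G.dInf c p q = 0 at h
    have h1 : ‖WithLp.fst p - WithLp.fst q‖ ≤ 0 := h ▸ le_max_left _ _
    have h2 : c * Real.sqrt ‖WithLp.snd p - WithLp.snd q
        + G.P (WithLp.fst p) (WithLp.fst q)‖ ≤ 0 := h ▸ le_max_right _ _
    have e1 : WithLp.fst p = WithLp.fst q := sub_eq_zero.1 (norm_le_zero_iff.1 h1)
    have h3 : Real.sqrt ‖WithLp.snd p - WithLp.snd q
        + G.P (WithLp.fst p) (WithLp.fst q)‖ ≤ 0 := by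
      by_contra hlt
      exact absurd h2 (not_le.2 (mul_pos hc.1 (not_le.1 hlt)))
    have h4 := Real.sqrt_eq_zero'.1 (le_antisymm h3 (Real.sqrt_nonneg _))
    rw [norm_le_zero_iff, e1, P_self, add_zero, sub_eq_zero] at h4
    exact Coord.ext_iff'.2 ⟨e1, h4⟩

noncomputable instance (c : ℝ) (hc : G.IsSuitable c) : MeasurableSpace (G.WithDInf c hc) :=
  borel _

instance (c : ℝ) (hc : G.IsSuitable c) : BorelSpace (G.WithDInf c hc) :=
  ⟨rfl⟩

/-- The `t`-dimensional Hausdorff measure of the metric `d_∞`, as an outer measure on all subsets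
of `ℝⁿ`. -/
noncomputable def homHausdorff (c : ℝ) (hc : G.IsSuitable c) (t : ℝ) :
    OuterMeasure (Coord m₁ m₂) :=
  (Measure.hausdorffMeasure t : Measure (G.WithDInf c hc)).toOuterMeasure

end StepTwoCarnotGroup

/-- The `s`-dimensional Hausdorff measure of the Euclidean metric of `ℝⁿ`. -/
noncomputable def euclHausdorff {m₁ m₂ : ℕ} (s : ℝ) : Measure (Coord m₁ m₂) :=
  Measure.hausdorffMeasure s

/-!
Call a set `N` concentrated if, for every `δ > 0`, around each of its points `p` and at all small
scales `r`, the part of `N ∩ B_E(p, r)` outside `V(p)(δ r)` has `ℋˢ_E`-measure at most `3/5 rˢ`.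
At an exceptional point of `A` this upper density is at most `2^{-(s+1)}` for every `δ`, that is,
the measure is at most `rˢ / 2` up to a factor close to `1`, and `1/2 < 3/5`. So the exceptional set
is concentrated, and the point is that bounded concentrated sets are null for `ℋ^{s+m₂}_𝔾`.

The metric geometry enters through one estimate (`exists_homContent_box_le`): a left translate of a
Euclidean product of balls of radii `r` and `l r`, `r ≤ l`, is covered by about `(l / r) ^ m₂` sets of
`d_∞`-diameter of order `r`, which costs `l ^ m₂ r ^ s` in dimension `s + m₂`. For a Euclidean ball
`l` is of order `1`, which yields `ℋ^{s+m₂}_𝔾 ≤ K ℋˢ_E` on bounded sets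
(`exists_homHausdorff_le`). For `B_E(p, r) ∩ V(p)(δ r)` it is of order `δ`
(`closedBall_inter_cthickening_subset_box`), which gains a factor `δ ^ m₂`.

Let `M` be a subset of a concentrated set; it is concentrated itself. By the density theorem for
arbitrary sets (`hausdorffMeasure_low_density_eq_zero`), almost every point of `M` is the centre of
arbitrarily small balls with `ℋˢ(M ∩ B) ≥ 4/5 rˢ`. The Besicovitch covering theorem gives disjoint
balls of this kind that cover almost all of `M`. The parts near the planes have content of order
`δ ^ m₂ ℋˢ(M)`, and the remaining parts have `ℋˢ`-measure at most `3/4 ℋˢ(M)`, since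
`(3/5) / (4/5) = 3/4` (`homContent_le_add`). Letting `δ → 0`, a bound `ℋ_𝔾 ≤ K ℋˢ` on all subsets
improves to `ℋ_𝔾 ≤ 3/4 K ℋˢ`. Iteration gives `ℋ_𝔾 = 0`
(`homHausdorff_eq_zero_of_concentrated`). Working with all subsets at once is what makes the
iteration possible, and no measurability of `A` is needed because both covering results hold for
arbitrary sets.
-/

/-! ### Hausdorff measures of arbitrary sets in metric spaces -/

/-- If `ν` of the part of `E` in every small ball centred on `E` is at most `K` times the `s`-th
power of the radius, then `ν E` is at most `K` times the Hausdorff measure of `E`: a set of diameter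
`d` that meets `E` lies in a ball of radius `d` centred on `E`. -/
theorem outerMeasure_le_mul_hausdorffMeasure {X : Type*} [MetricSpace X] [MeasurableSpace X]
    [BorelSpace X] (ν : OuterMeasure X) (E : Set X) {s : ℝ} (hs : 0 < s) {K : ℝ≥0∞} (hK0 : K ≠ 0)
    (hK : K ≠ ∞) {r₀ : ℝ} (hr₀ : 0 < r₀)
    (h : ∀ x ∈ E, ∀ r : ℝ, 0 < r → r ≤ r₀ →
      ν (E ∩ Metric.closedBall x r) ≤ K * ENNReal.ofReal (r ^ s)) :
    ν E ≤ K * Measure.hausdorffMeasure s E := by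
  have key : OuterMeasure.restrict E ν ≤
      OuterMeasure.mkMetric (K • fun x : ℝ≥0∞ => x ^ s) := by
    refine OuterMeasure.le_mkMetric _ _ (ENNReal.ofReal r₀) (by simpa using hr₀) fun U hU => ?_
    rw [OuterMeasure.restrict_apply]
    change ν (U ∩ E) ≤ K * Metric.ediam U ^ s
    rcases (U ∩ E).eq_empty_or_nonempty with he | ⟨x, hxU, hxE⟩
    · simp [he]
    have hball : ∀ r : ℝ, 0 < r → r ≤ r₀ → Metric.ediam U ≤ ENNReal.ofReal r →
        ν (U ∩ E) ≤ K * ENNReal.ofReal (r ^ s) := by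
      intro r hr hrr hd
      refine le_trans (ν.mono ?_) (h x hxE r hr hrr)
      rintro y ⟨hyU, hyE⟩
      refine ⟨hyE, ?_⟩
      have := (Metric.edist_le_ediam_of_mem hyU hxU).trans hd
      rw [edist_dist] at this
      exact (ENNReal.ofReal_le_ofReal_iff hr.le).1 this
    have htop : Metric.ediam U ≠ ∞ := ne_top_of_le_ne_top ENNReal.ofReal_ne_top hU
    rcases eq_or_ne (Metric.ediam U) 0 with h0 | h0
    · -- a set of diameter `0` lies in arbitrarily small balls
      rw [h0, ENNReal.zero_rpow_of_pos hs, mul_zero]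
      have ht : Tendsto (fun r : ℝ => K * ENNReal.ofReal (r ^ s)) (𝓝[>] 0) (𝓝 0) := by
        have h1 : Tendsto (fun r : ℝ => r ^ s) (𝓝[>] 0) (𝓝 0) := by
          have := (Real.continuousAt_rpow_const 0 s (Or.inr hs.le)).tendsto
          rw [Real.zero_rpow hs.ne'] at this
          exact this.mono_left nhdsWithin_le_nhds
        have h2 := ENNReal.Tendsto.const_mul (ENNReal.tendsto_ofReal h1) (Or.inr hK)
        simpa using h2
      refine ge_of_tendsto ht ?_
      filter_upwards [Ioc_mem_nhdsGT hr₀] with r hr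
      exact hball r hr.1 hr.2 (by simp [h0])
    · have hpos : 0 < (Metric.ediam U).toReal := ENNReal.toReal_pos h0 htop
      have := hball _ hpos (ENNReal.toReal_le_of_le_ofReal hr₀.le hU)
        (by rw [ENNReal.ofReal_toReal htop])
      rwa [← ENNReal.ofReal_rpow_of_pos hpos, ENNReal.ofReal_toReal htop] at this
  have h1 := key E
  rw [OuterMeasure.mkMetric_smul _ hK hK0, OuterMeasure.restrict_apply, Set.inter_self,
    _root_.smul_apply, OuterMeasure.coe_mkMetric] at h1
  exact h1

/-- The lower bound in the density theorem for Hausdorff measures, for arbitrary sets: at almost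
every point `x` of a set `M` of finite measure, `ℋˢ(M ∩ B(x, r)) > α rˢ` for arbitrarily small `r`,
for each `α < 1`. -/
theorem hausdorffMeasure_low_density_eq_zero {X : Type*} [MetricSpace X] [MeasurableSpace X]
    [BorelSpace X] {s : ℝ} (hs : 0 < s) {M : Set X} (hM : Measure.hausdorffMeasure s M ≠ ∞)
    {α : ℝ} (hα0 : 0 < α) (hα : α < 1) :
    Measure.hausdorffMeasure s {x ∈ M | ∃ ρ > 0, ∀ r : ℝ, 0 < r → r ≤ ρ →
      Measure.hausdorffMeasure s (M ∩ Metric.closedBall x r) ≤ ENNReal.ofReal (α * r ^ s)} = 0 := by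
  have hcover : {x ∈ M | ∃ ρ > 0, ∀ r : ℝ, 0 < r → r ≤ ρ →
      Measure.hausdorffMeasure s (M ∩ Metric.closedBall x r) ≤ ENNReal.ofReal (α * r ^ s)} ⊆
      ⋃ k : ℕ, {x ∈ M | ∀ r : ℝ, 0 < r → r ≤ 1 / ((k : ℝ) + 1) →
      Measure.hausdorffMeasure s (M ∩ Metric.closedBall x r) ≤ ENNReal.ofReal (α * r ^ s)} := by
    rintro x ⟨hx, ρ, hρ, hr⟩
    obtain ⟨k, hk⟩ := exists_nat_one_div_lt hρ
    exact Set.mem_iUnion.2 ⟨k, hx, fun r h0 h1 => hr r h0 (h1.trans hk.le)⟩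
  refine measure_mono_null hcover (measure_iUnion_null fun k => ?_)
  set E := {x ∈ M | ∀ r : ℝ, 0 < r → r ≤ 1 / ((k : ℝ) + 1) →
      Measure.hausdorffMeasure s (M ∩ Metric.closedBall x r) ≤ ENNReal.ofReal (α * r ^ s)} with hE
  have hEM : E ⊆ M := fun x hx => hx.1
  have hle : Measure.hausdorffMeasure s E ≤ ENNReal.ofReal α * Measure.hausdorffMeasure s E := by
    refine outerMeasure_le_mul_hausdorffMeasure
      (Measure.hausdorffMeasure s : Measure X).toOuterMeasure E hs
      (by simpa using hα0) ENNReal.ofReal_ne_top (r₀ := 1 / ((k : ℝ) + 1)) (by positivity) ?_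
    intro x hx r hr hrk
    rw [← ENNReal.ofReal_mul hα0.le]
    exact (measure_mono (Set.inter_subset_inter_left _ hEM)).trans (hx.2 r hr hrk)
  have hfin : Measure.hausdorffMeasure s E ≠ ∞ := ne_top_of_le_ne_top hM (measure_mono hEM)
  by_contra h0
  have hlt : ENNReal.ofReal α * Measure.hausdorffMeasure s E < 1 * Measure.hausdorffMeasure s E :=
    ENNReal.mul_lt_mul_left h0 hfin (by simpa using hα)
  rw [one_mul] at hlt
  exact absurd hle (not_le.2 hlt)

/-! ### Elementary inequalities -/

theorem EuclideanSpace.norm_le_sum_abs {n : ℕ} (x : EuclideanSpace ℝ (Fin n)) :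
    ‖x‖ ≤ ∑ j, |x j| := by
  rw [EuclideanSpace.norm_eq]
  refine Real.sqrt_le_iff.2 ⟨Finset.sum_nonneg fun _ _ => abs_nonneg _, ?_⟩
  exact Finset.sum_sq_le_sq_sum_of_nonneg fun _ _ => abs_nonneg _

theorem ENNReal.exists_pos_forall_ofReal_mul_le {D : ℝ} (hD : 0 < D) {η : ℝ≥0∞}
    (hη : 0 < η) : ∃ r₀ : ℝ, 0 < r₀ ∧ ∀ r ≤ r₀, ENNReal.ofReal (D * r) ≤ η := by
  have htop : min η 1 ≠ ∞ := ne_top_of_le_ne_top ENNReal.one_ne_top (min_le_right _ _)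
  have hpos : 0 < (min η 1).toReal :=
    ENNReal.toReal_pos (lt_min hη one_pos).ne' htop
  refine ⟨(min η 1).toReal / D, div_pos hpos hD, fun r hr => ?_⟩
  refine le_trans ?_ (min_le_left η 1)
  refine ENNReal.ofReal_le_of_le_toReal ?_
  rw [mul_comm]
  exact (le_div_iff₀ hD).1 hr

namespace StepTwoCarnotGroup

variable {m₁ m₂ : ℕ} (G : StepTwoCarnotGroup m₁ m₂)

/-! ### Approximations of the homogeneous Hausdorff measure -/

/-- The approximation of `homHausdorff` at scale `η`, in which only coverings by sets of
`d_∞`-diameter at most `η` compete. -/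
noncomputable def homContent (c : ℝ) (hc : G.IsSuitable c) (t : ℝ) (η : ℝ≥0∞) :
    OuterMeasure (Coord m₁ m₂) :=
  (OuterMeasure.mkMetric'.pre (fun S : Set (G.WithDInf c hc) => Metric.ediam S ^ t) η :
    OuterMeasure (G.WithDInf c hc))

theorem homHausdorff_eq_iSup (c : ℝ) (hc : G.IsSuitable c) (t : ℝ) (S : Set (Coord m₁ m₂)) :
    G.homHausdorff c hc t S = ⨆ η > 0, G.homContent c hc t η S := by
  have h : G.homHausdorff c hc t =
      (OuterMeasure.mkMetric (fun r => r ^ t) : OuterMeasure (G.WithDInf c hc)) :=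
    Measure.mkMetric_toOuterMeasure _
  have h' : ∀ U : Set (G.WithDInf c hc),
      (OuterMeasure.mkMetric (fun r => r ^ t) : OuterMeasure (G.WithDInf c hc)) U =
        ⨆ η > 0, OuterMeasure.mkMetric'.pre (fun V => Metric.ediam V ^ t) η U := fun U => by
    simp only [OuterMeasure.mkMetric, OuterMeasure.mkMetric', OuterMeasure.iSup_apply]
  rw [h]
  exact h' S

theorem homContent_le_homHausdorff (c : ℝ) (hc : G.IsSuitable c) (t : ℝ) {η : ℝ≥0∞} (hη : 0 < η)
    (S : Set (Coord m₁ m₂)) : G.homContent c hc t η S ≤ G.homHausdorff c hc t S := by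
  rw [homHausdorff_eq_iSup]
  exact le_iSup₂ (f := fun η (_ : η > 0) => G.homContent c hc t η S) η hη

theorem homContent_le_of_dInf_le (c : ℝ) (hc : G.IsSuitable c) {t : ℝ} (ht : 0 ≤ t) {η : ℝ≥0∞}
    {d : ℝ} (hdη : ENNReal.ofReal d ≤ η) (hd : 0 ≤ d) {S : Set (Coord m₁ m₂)}
    (hS : ∀ p ∈ S, ∀ q ∈ S, G.dInf c p q ≤ d) :
    G.homContent c hc t η S ≤ ENNReal.ofReal (d ^ t) := by
  have hdiam : Metric.ediam (show Set (G.WithDInf c hc) from S) ≤ ENNReal.ofReal d := by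
    refine Metric.ediam_le fun x hx y hy => ?_
    rw [edist_dist]
    exact ENNReal.ofReal_le_ofReal (hS x hx y hy)
  refine (OuterMeasure.mkMetric'.pre_le (X := G.WithDInf c hc) (hdiam.trans hdη)).trans ?_
  rw [← ENNReal.ofReal_rpow_of_nonneg hd ht]
  exact ENNReal.rpow_le_rpow hdiam ht

/-! ### The group law and boxes -/

/-- The left translate by `p` of the product of the ball of radius `r` in the first layer and the
ball of radius `a` in the second. -/
def box (p : Coord m₁ m₂) (r a : ℝ) : Set (Coord m₁ m₂) :=
  {q | ‖q.fst - p.fst‖ ≤ r ∧ ‖q.snd - p.snd - G.P p.fst q.fst‖ ≤ a}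

theorem P_sub_left (x x' y : EuclideanSpace ℝ (Fin m₁)) :
    G.P (x - x') y = G.P x y - G.P x' y := by
  rw [eq_sub_iff_add_eq, ← P_add_left, sub_add_cancel]

theorem P_sub_right (x y y' : EuclideanSpace ℝ (Fin m₁)) :
    G.P x (y - y') = G.P x y - G.P x y' := by
  rw [eq_sub_iff_add_eq, ← P_add_right, sub_add_cancel]

theorem exists_norm_P_le : ∃ L : ℝ, 0 ≤ L ∧ ∀ x y, ‖G.P x y‖ ≤ L * ‖x‖ * ‖y‖ := by
  refine ⟨∑ j, ∑ l, ∑ i ∈ Finset.Ioi l, |G.b j l i| * 2, by positivity, fun x y => ?_⟩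
  refine (EuclideanSpace.norm_le_sum_abs _).trans ?_
  simp only [Finset.sum_mul]
  refine Finset.sum_le_sum fun j _ => ?_
  change |∑ l, ∑ i ∈ Finset.Ioi l, G.b j l i * (x l * y i - x i * y l)| ≤ _
  refine (Finset.abs_sum_le_sum_abs _ _).trans (Finset.sum_le_sum fun l _ => ?_)
  refine (Finset.abs_sum_le_sum_abs _ _).trans (Finset.sum_le_sum fun i _ => ?_)
  rw [abs_mul, mul_assoc, mul_assoc]
  refine mul_le_mul_of_nonneg_left ?_ (abs_nonneg _)
  have hx : ∀ k, |x k| ≤ ‖x‖ := fun k => by simpa using PiLp.norm_apply_le x k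
  have hy : ∀ k, |y k| ≤ ‖y‖ := fun k => by simpa using PiLp.norm_apply_le y k
  calc |x l * y i - x i * y l| ≤ |x l * y i| + |x i * y l| := abs_sub _ _
    _ = |x l| * |y i| + |x i| * |y l| := by rw [abs_mul, abs_mul]
    _ ≤ ‖x‖ * ‖y‖ + ‖x‖ * ‖y‖ := by gcongr <;> apply_rules
    _ = 2 * (‖x‖ * ‖y‖) := by ring

/-- Two points of a box whose second-layer coordinates, relative to the centre, differ by at most
`m r²` have `d_∞`-distance of order `r`: the correction term is `P` of two vectors of
length `≤ r`. -/
theorem dInf_le_of_mem_box {c : ℝ} (hc : G.IsSuitable c) {L : ℝ} (hL0 : 0 ≤ L)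
    (hL : ∀ x y, ‖G.P x y‖ ≤ L * ‖x‖ * ‖y‖) {p q q' : Coord m₁ m₂} {r m : ℝ} (hr : 0 ≤ r)
    (hm : 0 ≤ m) (hq : ‖q.fst - p.fst‖ ≤ r) (hq' : ‖q'.fst - p.fst‖ ≤ r)
    (h : ‖(q.snd - p.snd - G.P p.fst q.fst) - (q'.snd - p.snd - G.P p.fst q'.fst)‖ ≤ m * r ^ 2) :
    G.dInf c q q' ≤ (2 + m + L) * r := by
  refine max_le ?_ ?_
  · have : q.fst - q'.fst = (q.fst - p.fst) - (q'.fst - p.fst) := by abel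
    rw [this]
    refine (norm_sub_le _ _).trans ?_
    nlinarith [mul_nonneg hm hr, mul_nonneg hL0 hr]
  · have e : q.snd - q'.snd + G.P q.fst q'.fst =
        ((q.snd - p.snd - G.P p.fst q.fst) - (q'.snd - p.snd - G.P p.fst q'.fst)) +
          G.P (q.fst - p.fst) (q'.fst - p.fst) := by
      simp only [P_sub_left, P_sub_right, P_self]
      rw [G.P_neg_swap p.fst q.fst]
      abel
    have h1 : ‖G.P (q.fst - p.fst) (q'.fst - p.fst)‖ ≤ L * r ^ 2 := by
      refine (hL _ _).trans ?_
      rw [mul_assoc, pow_two]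
      gcongr
    have h2 : ‖q.snd - q'.snd + G.P q.fst q'.fst‖ ≤ ((2 + m + L) * r) ^ 2 := by
      rw [e]
      refine (norm_add_le _ _).trans ((add_le_add h h1).trans ?_)
      rw [mul_pow, ← add_mul]
      refine mul_le_mul_of_nonneg_right ?_ (sq_nonneg _)
      nlinarith
    have h3 : Real.sqrt ‖q.snd - q'.snd + G.P q.fst q'.fst‖ ≤ (2 + m + L) * r :=
      Real.sqrt_le_iff.2 ⟨by positivity, h2⟩
    calc c * Real.sqrt ‖q.snd - q'.snd + G.P q.fst q'.fst‖
        ≤ 1 * Real.sqrt ‖q.snd - q'.snd + G.P q.fst q'.fst‖ :=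
          mul_le_mul_of_nonneg_right hc.2.1.le (Real.sqrt_nonneg _)
      _ ≤ _ := by rwa [one_mul]

/-! ### Content of boxes and comparison with Euclidean balls -/

/-- A box of horizontal radius `r` and vertical radius `l r ≥ r²` has content of order
`l ^ m₂ * r ^ s` in dimension `s + m₂`: a grid of mesh `r²` in the second layer cuts it into about
`(l / r) ^ m₂` sets of `d_∞`-diameter of order `r`. -/
theorem exists_homContent_box_le (c : ℝ) (hc : G.IsSuitable c) {s : ℝ} (hs : 0 ≤ s) :
    ∃ C D : ℝ, 0 < C ∧ 0 < D ∧ ∀ (p : Coord m₁ m₂) (r l : ℝ) (η : ℝ≥0∞), 0 < r → r ≤ l →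
      ENNReal.ofReal (D * r) ≤ η →
      G.homContent c hc (s + m₂) η (G.box p r (l * r)) ≤ ENNReal.ofReal (C * l ^ m₂ * r ^ s) := by
  obtain ⟨L, hL0, hL⟩ := G.exists_norm_P_le
  set D : ℝ := 2 + m₂ + L with hD
  have hDpos : 0 < D := by positivity
  refine ⟨5 ^ m₂ * D ^ (s + m₂), D, by positivity, hDpos, fun p r l η hr hrl hη => ?_⟩
  set w : Coord m₁ m₂ → EuclideanSpace ℝ (Fin m₂) :=
    fun q => q.snd - p.snd - G.P p.fst q.fst with hw
  set N : ℤ := ⌈l / r⌉ with hN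
  set I : Finset (Fin m₂ → ℤ) := Fintype.piFinset fun _ => Finset.Icc (-N) N with hI
  set cell : (Fin m₂ → ℤ) → Set (Coord m₁ m₂) :=
    fun k => {q | ‖q.fst - p.fst‖ ≤ r ∧ ∀ j, ⌊w q j / r ^ 2⌋ = k j} with hcell
  have hlr : 1 ≤ l / r := (one_le_div hr).2 hrl
  have hsub : G.box p r (l * r) ⊆ ⋃ k ∈ I, cell k := by
    rintro q ⟨hq1, hq2⟩
    refine Set.mem_iUnion₂.2 ⟨fun j => ⌊w q j / r ^ 2⌋, ?_, hq1, fun _ => rfl⟩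
    rw [hI, Fintype.mem_piFinset]
    intro j
    have hwj : |w q j| ≤ l * r := by
      refine le_trans ?_ hq2
      simpa using PiLp.norm_apply_le (w q) j
    have habs : |w q j / r ^ 2| ≤ l / r := by
      rw [abs_div, abs_of_pos (pow_pos hr 2), div_le_div_iff₀ (pow_pos hr 2) hr]
      nlinarith
    rw [Finset.mem_Icc]
    have hNl : l / r ≤ N := Int.le_ceil _
    constructor
    · rw [Int.le_floor]
      push_cast
      linarith [neg_le_of_abs_le habs]
    · exact Int.cast_le.1 ((Int.floor_le (w q j / r ^ 2)).trans ((le_of_abs_le habs).trans hNl))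
  have hcellle : ∀ k, G.homContent c hc (s + m₂) η (cell k) ≤
      ENNReal.ofReal ((D * r) ^ (s + m₂)) := by
    intro k
    refine G.homContent_le_of_dInf_le c hc (by positivity) hη (by positivity) ?_
    rintro q ⟨hq1, hq2⟩ q' ⟨hq1', hq2'⟩
    refine G.dInf_le_of_mem_box hc hL0 hL hr.le (Nat.cast_nonneg _) hq1 hq1' ?_
    refine (EuclideanSpace.norm_le_sum_abs _).trans ?_
    have hle : ∀ j ∈ Finset.univ, |(w q - w q') j| ≤ r ^ 2 := by
      intro j _
      have h := Int.abs_sub_lt_one_of_floor_eq_floor ((hq2 j).trans (hq2' j).symm)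
      rw [← sub_div, abs_div, abs_of_pos (pow_pos hr 2), div_lt_one (pow_pos hr 2)] at h
      exact h.le
    refine (Finset.sum_le_sum hle).trans ?_
    simp
  have hcard : (I.card : ℝ) ≤ (5 * (l / r)) ^ m₂ := by
    have hN0 : 0 ≤ N := Int.ceil_nonneg (by linarith)
    have hc1 : I.card = (Finset.Icc (-N) N).card ^ m₂ := by
      rw [hI, Fintype.card_piFinset]
      simp
    rw [hc1, Int.card_Icc]
    push_cast
    gcongr
    have : ((N + 1 - -N).toNat : ℤ) = 2 * N + 1 := by omega
    have h2 : (((N + 1 - -N).toNat : ℤ) : ℝ) = 2 * N + 1 := by rw [this]; push_cast; ring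
    have h3 : ((N + 1 - -N).toNat : ℝ) = 2 * N + 1 := by exact_mod_cast h2
    rw [h3]
    have := Int.ceil_lt_add_one (l / r)
    rw [← hN] at this
    linarith
  calc G.homContent c hc (s + m₂) η (G.box p r (l * r))
      ≤ G.homContent c hc (s + m₂) η (⋃ k ∈ I, cell k) := measure_mono hsub
    _ ≤ ∑ k ∈ I, G.homContent c hc (s + m₂) η (cell k) := measure_biUnion_finset_le _ _
    _ ≤ ∑ _k ∈ I, ENNReal.ofReal ((D * r) ^ (s + m₂)) := Finset.sum_le_sum fun k _ => hcellle k
    _ = ENNReal.ofReal (I.card * (D * r) ^ (s + m₂)) := by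
      rw [Finset.sum_const, nsmul_eq_mul, ENNReal.ofReal_mul (Nat.cast_nonneg _),
        ENNReal.ofReal_natCast]
    _ ≤ ENNReal.ofReal ((5 * (l / r)) ^ m₂ * (D * r) ^ (s + m₂)) := by gcongr
    _ = _ := by
      congr 1
      rw [Real.mul_rpow hDpos.le hr.le, Real.rpow_add hr, Real.rpow_natCast, mul_pow, div_pow]
      field_simp

/-- A Euclidean ball of radius `r` is contained in a box whose vertical radius is of order `r`,
uniformly for centres in a bounded set. -/
theorem closedBall_subset_box {L R : ℝ} (hL0 : 0 ≤ L) (hL : ∀ x y, ‖G.P x y‖ ≤ L * ‖x‖ * ‖y‖)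
    {p : Coord m₁ m₂} (hp : ‖p‖ ≤ R) {r : ℝ} :
    Metric.closedBall p r ⊆ G.box p r ((1 + L * R) * r) := by
  intro q hq
  rw [mem_closedBall_iff_norm] at hq
  have h1 : ‖q.fst - p.fst‖ ≤ r := (WithLp.norm_fst_le _ (q - p)).trans hq
  have h2 : ‖q.snd - p.snd‖ ≤ r := (WithLp.norm_snd_le _ (q - p)).trans hq
  refine ⟨h1, ?_⟩
  have e : G.P p.fst q.fst = G.P p.fst (q.fst - p.fst) := by
    rw [P_sub_right, P_self, sub_zero]
  have hR : 0 ≤ R := (norm_nonneg p).trans hp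
  have hp1 : ‖p.fst‖ ≤ R := (WithLp.norm_fst_le _ p).trans hp
  have h3 : ‖G.P p.fst q.fst‖ ≤ L * R * r := by
    rw [e]
    exact (hL _ _).trans (by gcongr)
  exact (norm_sub_le _ _).trans (by linarith)

/-- The part of a Euclidean ball of radius `r` that lies within `δ r` of the horizontal plane
through its centre is contained in a box whose vertical radius is of order `δ r`. -/
theorem closedBall_inter_cthickening_subset_box {L R : ℝ} (hL0 : 0 ≤ L)
    (hL : ∀ x y, ‖G.P x y‖ ≤ L * ‖x‖ * ‖y‖) {p : Coord m₁ m₂} (hp : ‖p‖ ≤ R) {r δ : ℝ}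
    (hr : 0 < r) (hδ : 0 < δ) :
    Metric.closedBall p r ∩ Metric.cthickening (δ * r) (G.horizontalPlane p) ⊆
      G.box p r (2 * (1 + L * R) * δ * r) := by
  rintro q ⟨hq, hqV⟩
  rw [mem_closedBall_iff_norm] at hq
  have h1 : ‖q.fst - p.fst‖ ≤ r := (WithLp.norm_fst_le _ (q - p)).trans hq
  refine ⟨h1, ?_⟩
  have hδr : 0 < δ * r := mul_pos hδ hr
  have hlt : Metric.infEDist q (G.horizontalPlane p) < ENNReal.ofReal (2 * (δ * r)) :=
    (Metric.mem_cthickening_iff.1 hqV).trans_lt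
      ((ENNReal.ofReal_lt_ofReal_iff (by linarith)).2 (by linarith))
  obtain ⟨z, ⟨v, hv, rfl⟩, hz⟩ := Metric.infEDist_lt_iff.1 hlt
  have hv0 : v.snd = 0 := hv
  rw [edist_dist, ENNReal.ofReal_lt_ofReal_iff (by linarith), dist_eq_norm] at hz
  have h2 : ‖q.fst - (p.fst + v.fst)‖ ≤ 2 * (δ * r) :=
    (WithLp.norm_fst_le _ (q - G.mul p v)).trans hz.le
  have h3 : ‖q.snd - (p.snd + v.snd + G.P p.fst v.fst)‖ ≤ 2 * (δ * r) :=
    (WithLp.norm_snd_le _ (q - G.mul p v)).trans hz.le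
  have e : q.snd - p.snd - G.P p.fst q.fst = (q.snd - (p.snd + v.snd + G.P p.fst v.fst)) -
      G.P p.fst (q.fst - (p.fst + v.fst)) := by
    rw [P_sub_right, P_add_right, P_self, hv0]
    abel
  have hR : 0 ≤ R := (norm_nonneg p).trans hp
  have hp1 : ‖p.fst‖ ≤ R := (WithLp.norm_fst_le _ p).trans hp
  rw [e]
  have h4 : ‖G.P p.fst (q.fst - (p.fst + v.fst))‖ ≤ L * R * (2 * (δ * r)) :=
    (hL _ _).trans (by gcongr)
  exact (norm_sub_le _ _).trans (by linarith)

/-- On bounded sets the homogeneous Hausdorff measure of dimension `s + m₂` is controlled by the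
Euclidean one of dimension `s`. -/
theorem exists_homHausdorff_le (c : ℝ) (hc : G.IsSuitable c) {s : ℝ} (hs : 0 < s) {R : ℝ}
    (hR : 0 ≤ R) : ∃ K : ℝ≥0∞, K ≠ ∞ ∧ ∀ M : Set (Coord m₁ m₂), (∀ p ∈ M, ‖p‖ ≤ R) →
      G.homHausdorff c hc (s + m₂) M ≤ K * euclHausdorff s M := by
  obtain ⟨L, hL0, hL⟩ := G.exists_norm_P_le
  obtain ⟨C, D, hC, hD, hbox⟩ := G.exists_homContent_box_le c hc hs.le
  set l : ℝ := 1 + L * R with hl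
  have hlpos : 0 < l := by positivity
  refine ⟨ENNReal.ofReal (C * l ^ m₂), ENNReal.ofReal_ne_top, fun M hM => ?_⟩
  rw [homHausdorff_eq_iSup]
  refine iSup₂_le fun η hη => ?_
  obtain ⟨r₀, hr₀, hr₀'⟩ := ENNReal.exists_pos_forall_ofReal_mul_le hD hη
  refine outerMeasure_le_mul_hausdorffMeasure _ M hs
    (by simpa using (by positivity : 0 < C * l ^ m₂)) ENNReal.ofReal_ne_top
    (lt_min hr₀ hlpos) ?_
  intro p hp r hr hrr
  rw [← ENNReal.ofReal_mul (by positivity)]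
  refine le_trans (measure_mono ?_)
    (hbox p r l η hr (hrr.trans (min_le_right _ _)) (hr₀' r (hrr.trans (min_le_left _ _))))
  exact Set.inter_subset_right.trans (G.closedBall_subset_box hL0 hL (hM p hp))

/-! ### Sets concentrated near horizontal planes -/

/-- Covering of a set `M` that, around each of its points, concentrates near horizontal planes at
all small scales: up to a null set, `M` splits into a part inside countably many boxes, whose
content is of order `δ ^ m₂ ℋˢ(M)`, and a part of `ℋˢ`-measure at most `3/4 ℋˢ(M)`, to which the
given comparison constant `K` applies. -/
theorem homContent_le_add (c : ℝ) (hc : G.IsSuitable c) {s : ℝ} (hs : 0 < s) {R : ℝ}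
    (hR : 0 ≤ R) : ∃ C : ℝ, 0 < C ∧ ∀ (M : Set (Coord m₁ m₂)), (∀ p ∈ M, ‖p‖ ≤ R) →
      euclHausdorff s M ≠ ∞ → ∀ δ : ℝ, 0 < δ →
      (∀ p ∈ M, ∀ᶠ r in 𝓝[>] (0 : ℝ),
        euclHausdorff s ((M ∩ Metric.closedBall p r) \
          Metric.cthickening (δ * r) (G.horizontalPlane p)) ≤ ENNReal.ofReal (3 / 5 * r ^ s)) →
      ∀ K : ℝ≥0∞, (∀ M' ⊆ M, G.homHausdorff c hc (s + m₂) M' ≤ K * euclHausdorff s M') →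
      ∀ η : ℝ≥0∞, 0 < η → G.homContent c hc (s + m₂) η M ≤
        ENNReal.ofReal (C * δ ^ m₂) * euclHausdorff s M +
          K * (ENNReal.ofReal (3 / 4) * euclHausdorff s M) := by
  obtain ⟨L, hL0, hL⟩ := G.exists_norm_P_le
  obtain ⟨C, D, hC, hD, hbox⟩ := G.exists_homContent_box_le c hc hs.le
  refine ⟨C * (2 * (1 + L * R)) ^ m₂ * (5 / 4), by positivity, ?_⟩
  intro M hM hfin δ hδ hbad K hK η hη
  set H : Measure (Coord m₁ m₂) := euclHausdorff s with hH
  set l : ℝ := 2 * (1 + L * R) * δ with hl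
  have hlpos : 0 < l := by positivity
  obtain ⟨r₀, hr₀, hr₀'⟩ := ENNReal.exists_pos_forall_ofReal_mul_le hD hη
  set V : Coord m₁ m₂ → ℝ → Set (Coord m₁ m₂) :=
    fun p r => Metric.cthickening (δ * r) (G.horizontalPlane p) with hV
  set Z : Set (Coord m₁ m₂) := {x ∈ M | ∃ ρ > 0, ∀ r : ℝ, 0 < r → r ≤ ρ →
      H (M ∩ Metric.closedBall x r) ≤ ENNReal.ofReal (4 / 5 * r ^ s)} with hZ
  have hZ0 : H Z = 0 := hausdorffMeasure_low_density_eq_zero hs hfin (by norm_num) (by norm_num)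
  -- the admissible radii: `M` has nearly full density in the ball, and little of it off the plane
  set f : Coord m₁ m₂ → Set ℝ := fun x => {r | r ≤ min r₀ l ∧
    ENNReal.ofReal (4 / 5 * r ^ s) ≤ H (M ∩ Metric.closedBall x r) ∧
    H ((M ∩ Metric.closedBall x r) \ V x r) ≤ ENNReal.ofReal (3 / 5 * r ^ s)} with hf
  have hfine : ∀ x ∈ M \ Z, ∀ ε > 0, (f x ∩ Set.Ioo 0 ε).Nonempty := by
    rintro x ⟨hxM, hxZ⟩ ε hε
    obtain ⟨ρ, hρ, hρ'⟩ := mem_nhdsGT_iff_exists_Ioc_subset.1 (hbad x hxM)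
    have hρ0 : (0 : ℝ) < ρ := hρ
    by_contra hne
    refine hxZ ⟨hxM, min (min r₀ l) (min ρ (ε / 2)), by positivity, fun r hr hrr => ?_⟩
    simp only [le_min_iff] at hrr
    by_contra hlt
    exact hne ⟨r, ⟨le_min hrr.1.1 hrr.1.2, (not_le.1 hlt).le, hρ' ⟨hr, hrr.2.1⟩⟩, hr,
      by linarith [hrr.2.2]⟩
  have : IsFiniteMeasure (H.restrict M) := ⟨by simpa using hfin.lt_top⟩
  obtain ⟨t, r, htc, htM, hr, hnull, hdisj⟩ :=
    Besicovitch.exists_disjoint_closedBall_covering_ae (H.restrict M) f (M \ Z) hfine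
      (fun _ => 1) (fun _ _ => one_pos)
  set B : Coord m₁ m₂ → Set (Coord m₁ m₂) := fun x => Metric.closedBall x (r x) with hB
  have hnull' : H ((M \ Z) \ ⋃ x ∈ t, B x) = 0 := by
    refine le_antisymm (le_trans (measure_mono ?_) ((Measure.le_restrict_apply M _).trans
      hnull.le)) zero_le
    exact fun x hx => ⟨hx, hx.1.1⟩
  have hrestr : ∀ x, H (M ∩ B x) = H.restrict M (B x) := fun x => by
    rw [Measure.restrict_apply Metric.isClosed_closedBall.measurableSet, Set.inter_comm]
  have hsum : ∑' x : t, H (M ∩ B x) ≤ H M := by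
    calc ∑' x : t, H (M ∩ B x) = ∑' x : t, H.restrict M (B x) := by simp only [hrestr]
      _ = H.restrict M (⋃ x ∈ t, B x) :=
        (measure_biUnion htc hdisj fun x _ => Metric.isClosed_closedBall.measurableSet).symm
      _ ≤ H.restrict M Set.univ := measure_mono (Set.subset_univ _)
      _ = H M := Measure.restrict_apply_univ M
  set ν := G.homContent c hc (s + m₂) η with hν
  have hνK : ∀ M' ⊆ M, ν M' ≤ K * H M' := fun M' h =>
    (G.homContent_le_homHausdorff c hc _ hη M').trans (hK M' h)
  have hnear : ν (⋃ x ∈ t, M ∩ B x ∩ V x (r x)) ≤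
      ENNReal.ofReal (C * (2 * (1 + L * R)) ^ m₂ * (5 / 4) * δ ^ m₂) * H M := by
    refine (measure_biUnion_le ν htc _).trans ?_
    refine le_trans ?_ (mul_le_mul_right hsum _)
    rw [← ENNReal.tsum_mul_left]
    refine ENNReal.tsum_le_tsum fun x => ?_
    obtain ⟨⟨hx1, hx2, hx3⟩, hx4, -⟩ := hr x x.2
    refine le_trans (measure_mono (t := G.box x (r x) (l * r x)) ?_) ((hbox x (r x) l η hx4
      (hx1.trans (min_le_right _ _)) (hr₀' _ (hx1.trans (min_le_left _ _)))).trans ?_)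
    · refine Set.Subset.trans ?_ (G.closedBall_inter_cthickening_subset_box hL0 hL
        (hM x (htM x.2).1) hx4 hδ)
      exact fun y hy => ⟨hy.1.2, hy.2⟩
    · refine le_trans (le_of_eq ?_) (mul_le_mul_right hx2 _)
      rw [← ENNReal.ofReal_mul (by positivity)]
      congr 1
      rw [hl, mul_pow _ δ]
      ring
  have hfar : ν (⋃ x ∈ t, (M ∩ B x) \ V x (r x)) ≤ K * (ENNReal.ofReal (3 / 4) * H M) := by
    refine (hνK _ (Set.iUnion₂_subset fun x _ y hy => hy.1.1)).trans ?_
    refine mul_le_mul_right ((measure_biUnion_le H htc _).trans ?_) K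
    refine le_trans ?_ (mul_le_mul_right hsum _)
    rw [← ENNReal.tsum_mul_left]
    refine ENNReal.tsum_le_tsum fun x => ?_
    obtain ⟨⟨hx1, hx2, hx3⟩, hx4, -⟩ := hr x x.2
    refine hx3.trans (le_trans (le_of_eq ?_) (mul_le_mul_right hx2 _))
    rw [← ENNReal.ofReal_mul (by norm_num)]
    congr 1
    ring
  have hZν : ν Z = 0 :=
    le_antisymm ((hνK Z fun x hx => hx.1).trans (by rw [hZ0, mul_zero])) zero_le
  have hnullν : ν ((M \ Z) \ ⋃ x ∈ t, B x) = 0 :=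
    le_antisymm ((hνK _ fun x hx => hx.1.1).trans (by rw [hnull', mul_zero])) zero_le
  have hcover : M ⊆ (Z ∪ ((M \ Z) \ ⋃ x ∈ t, B x)) ∪
      ((⋃ x ∈ t, M ∩ B x ∩ V x (r x)) ∪ ⋃ x ∈ t, (M ∩ B x) \ V x (r x)) := by
    intro y hy
    by_cases hyZ : y ∈ Z
    · exact Or.inl (Or.inl hyZ)
    by_cases hyB : y ∈ ⋃ x ∈ t, B x
    · obtain ⟨x, hx, hyx⟩ := Set.mem_iUnion₂.1 hyB
      by_cases hyV : y ∈ V x (r x)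
      · exact Or.inr (Or.inl (Set.mem_iUnion₂.2 ⟨x, hx, ⟨hy, hyx⟩, hyV⟩))
      · exact Or.inr (Or.inr (Set.mem_iUnion₂.2 ⟨x, hx, ⟨hy, hyx⟩, hyV⟩))
    · exact Or.inl (Or.inr ⟨⟨hy, hyZ⟩, hyB⟩)
  calc ν M ≤ _ := measure_mono hcover
    _ ≤ (ν Z + ν ((M \ Z) \ ⋃ x ∈ t, B x)) + (ν (⋃ x ∈ t, M ∩ B x ∩ V x (r x)) +
        ν (⋃ x ∈ t, (M ∩ B x) \ V x (r x))) :=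
      (measure_union_le _ _).trans (add_le_add (measure_union_le _ _) (measure_union_le _ _))
    _ ≤ _ := by
      rw [hZν, hnullν, add_zero, zero_add]
      exact add_le_add hnear hfar

/-- A bounded set of finite Euclidean measure that, around each of its points, concentrates near
horizontal planes at all small scales and for all apertures `δ` is a null set for the homogeneous
measure: a bound of the homogeneous by the Euclidean measure on all subsets improves by the
factor `3/4`. -/
theorem homHausdorff_eq_zero_of_concentrated (c : ℝ) (hc : G.IsSuitable c) {s : ℝ} (hs : 0 < s)
    {R : ℝ} (hR : 0 ≤ R) {N : Set (Coord m₁ m₂)} (hN : ∀ p ∈ N, ‖p‖ ≤ R)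
    (hfin : euclHausdorff s N ≠ ∞)
    (hbad : ∀ p ∈ N, ∀ δ : ℝ, 0 < δ → ∀ᶠ r in 𝓝[>] (0 : ℝ),
      euclHausdorff s ((N ∩ Metric.closedBall p r) \
        Metric.cthickening (δ * r) (G.horizontalPlane p)) ≤ ENNReal.ofReal (3 / 5 * r ^ s)) :
    G.homHausdorff c hc (s + m₂) N = 0 := by
  obtain ⟨K, hKtop, hK⟩ := G.exists_homHausdorff_le c hc hs hR
  obtain ⟨C, hC, hstep⟩ := G.homContent_le_add c hc hs hR
  have hiter : ∀ n : ℕ, ∀ M ⊆ N, G.homHausdorff c hc (s + m₂) M ≤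
      K * ENNReal.ofReal (3 / 4) ^ n * euclHausdorff s M := by
    intro n
    induction n with
    | zero =>
      intro M hM
      simpa using hK M fun p hp => hN p (hM hp)
    | succ n ih =>
      intro M hM
      have hMfin : euclHausdorff s M ≠ ∞ := ne_top_of_le_ne_top hfin (measure_mono hM)
      rw [homHausdorff_eq_iSup]
      refine iSup₂_le fun η hη => ?_
      have hδ : ∀ δ : ℝ, 0 < δ → G.homContent c hc (s + m₂) η M ≤
          ENNReal.ofReal (C * δ ^ m₂) * euclHausdorff s M +
            K * ENNReal.ofReal (3 / 4) ^ n * (ENNReal.ofReal (3 / 4) * euclHausdorff s M) := by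
        intro δ hδ
        refine hstep M (fun p hp => hN p (hM hp)) hMfin δ hδ (fun p hp => ?_) _
          (fun M' hM' => ih M' (hM'.trans hM)) η hη
        filter_upwards [hbad p (hM hp) δ hδ] with r hr
        refine le_trans (measure_mono ?_) hr
        exact fun y hy => ⟨⟨hM hy.1.1, hy.1.2⟩, hy.2⟩
      have ht : Tendsto (fun δ : ℝ => ENNReal.ofReal (C * δ ^ m₂) * euclHausdorff s M +
          K * ENNReal.ofReal (3 / 4) ^ n * (ENNReal.ofReal (3 / 4) * euclHausdorff s M))
          (𝓝[>] 0) (𝓝 (0 * euclHausdorff s M +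
          K * ENNReal.ofReal (3 / 4) ^ n * (ENNReal.ofReal (3 / 4) * euclHausdorff s M))) := by
        refine Tendsto.add_const _ (ENNReal.Tendsto.mul_const ?_ (Or.inr hMfin))
        have h1 : Continuous fun δ : ℝ => C * δ ^ m₂ := by fun_prop
        have h2 := ENNReal.tendsto_ofReal (h1.tendsto 0)
        -- the vertical dimension `m₂` is positive, so the near part disappears as `δ → 0`
        rw [zero_pow G.step_two.ne', mul_zero, ENNReal.ofReal_zero] at h2
        exact h2.mono_left nhdsWithin_le_nhds
      have hlim := ge_of_tendsto ht (eventually_mem_nhdsWithin.mono fun δ h => hδ δ h)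
      rw [zero_mul, zero_add] at hlim
      rwa [pow_succ, ← mul_assoc, mul_assoc]
  have ht : Tendsto (fun n : ℕ => K * ENNReal.ofReal (3 / 4) ^ n * euclHausdorff s N) atTop
      (𝓝 (K * 0 * euclHausdorff s N)) :=
    ENNReal.Tendsto.mul_const (ENNReal.Tendsto.const_mul
      (ENNReal.tendsto_pow_atTop_nhds_zero_of_lt_one (by norm_num)) (Or.inr hKtop)) (Or.inr hfin)
  rw [mul_zero, zero_mul] at ht
  exact le_antisymm (ge_of_tendsto' ht fun n => hiter n N subset_rfl) zero_le

end StepTwoCarnotGroup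

theorem theorem2 {m₁ m₂ : ℕ} (G : StepTwoCarnotGroup m₁ m₂) (c : ℝ) (hc : G.IsSuitable c)
    (s : ℝ) (hs : (m₂ : ℝ) ≤ s) (A : Set (Coord m₁ m₂)) (hA : euclHausdorff s A < ∞) :
    ∀ᵐ p ∂(G.homHausdorff c hc (s + m₂)), p ∈ A →
      ∃ δ : ℝ, 0 < δ ∧
        ENNReal.ofReal (1 / (2 : ℝ) ^ (s + 1)) <
          limsup (fun r : ℝ =>
            euclHausdorff s
                ((A ∩ Metric.closedBall p r) \ Metric.cthickening (δ * r) (G.horizontalPlane p)) /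
              ENNReal.ofReal ((2 * r) ^ s)) (𝓝[>] 0) := by
  have hs0 : 0 < s := lt_of_lt_of_le (by exact_mod_cast G.step_two) hs
  rw [ae_iff]
  set B : Set (Coord m₁ m₂) := {p | ¬(p ∈ A → ∃ δ : ℝ, 0 < δ ∧
    ENNReal.ofReal (1 / (2 : ℝ) ^ (s + 1)) <
      limsup (fun r : ℝ =>
        euclHausdorff s
            ((A ∩ Metric.closedBall p r) \ Metric.cthickening (δ * r) (G.horizontalPlane p)) /
          ENNReal.ofReal ((2 * r) ^ s)) (𝓝[>] 0))} with hB
  have hcover : B ⊆ ⋃ n : ℕ, B ∩ {p | ‖p‖ ≤ n} := fun p hp =>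
    let ⟨n, hn⟩ := exists_nat_ge ‖p‖
    Set.mem_iUnion.2 ⟨n, hp, hn⟩
  refine measure_mono_null hcover (measure_iUnion_null fun n => ?_)
  have hBA : B ⊆ A := fun p hp => (Classical.not_imp.1 hp).1
  have hsub : B ∩ {p | ‖p‖ ≤ n} ⊆ A := Set.inter_subset_left.trans hBA
  refine G.homHausdorff_eq_zero_of_concentrated c hc hs0 (Nat.cast_nonneg n) (fun p hp => hp.2)
    (ne_top_of_le_ne_top hA.ne (measure_mono hsub)) ?_
  rintro p ⟨hp, -⟩ δ hδ
  have hlim := not_lt.1 fun h => (Classical.not_imp.1 hp).2 ⟨δ, hδ, h⟩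
  have h2s : (0 : ℝ) < 2 ^ s := by positivity
  have hlt : ENNReal.ofReal (1 / (2 : ℝ) ^ (s + 1)) < ENNReal.ofReal (3 / 5 / 2 ^ s) := by
    rw [ENNReal.ofReal_lt_ofReal_iff (by positivity), Real.rpow_add two_pos, Real.rpow_one,
      div_lt_div_iff₀ (by positivity) h2s]
    nlinarith
  filter_upwards [eventually_lt_of_limsup_lt (hlim.trans_lt hlt), self_mem_nhdsWithin] with r hr hr0
  have hr0' : (0 : ℝ) < r := hr0
  have hrs : (0 : ℝ) < (2 * r) ^ s := by positivity
  have h := (ENNReal.div_le_iff (by simpa using hrs) ENNReal.ofReal_ne_top).1 hr.le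
  have e : ENNReal.ofReal (3 / 5 / 2 ^ s) * ENNReal.ofReal ((2 * r) ^ s) =
      ENNReal.ofReal (3 / 5 * r ^ s) := by
    rw [← ENNReal.ofReal_mul (by positivity), Real.mul_rpow two_pos.le hr0'.le]
    congr 1
    field_simp
  rw [e] at h
  refine le_trans (measure_mono ?_) h
  exact fun y hy => ⟨⟨hsub hy.1.1, hy.1.2⟩, hy.2⟩
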